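/- Let $H$ be a complex Hilbert space. A JW-algebra on $H$ is a real linear space $A$ of bounded self-adjoint operators on $H$ that is closed under the Jordan product $a\circ b=\frac12(ab+ba)$ and closed in the weak operator topology; it is reversible if $a_1a_2\cdots a_n+a_n\cdots a_2a_1\in A$ for all $n\ge 1$ and $a_1,\dots,a_n\in A$. Let $A$ be a reversible JW-algebra with identity element $1_A$ (a projection in $B(H)$, equal to the identity operator when the latter lies in $A$), let $A^+$ be the set of its positive elements and $\operatorname{Proj}A$ the set of its projections, and put $p^\perp=1_A-p$ for $p\in\operatorname{Proj}A$. Let $\rho$ be a faithful normal state on $A$, that is, a positive real-linear functional with $\rho(1_A)=1$, such that $\rho(a)=0$ with $a\in A^+$ implies $a=0$, and such that $\rho(\sup_\alpha a_\alpha)=\sup_\alpha\rho(a_\alpha)$ for every increasing net $(a_\alpha)$ in $A$ that has a supremum in $A$. For a sequence $(D_m)_{m\ge1}$ in $A^+$ with $\sum_{m=1}^\infty\rho(D_m)<\infty$, the bundle determined by $(D_m)$ is the set $$\mathcal P_{(D_m)}=\Big\{p\in\operatorname{Proj}A:\ p\ne0,\ \sup_m\Big\|p\Big(\sum_{k=1}^m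 D_k\Big)p\Big\|<\infty\ \text{ and }\ \|pD_mp\|\to0\ \text{ as } m\to\infty\Big\}.$$ Let $x_n,x\in A$ $(n=1,2,\dots)$. The sequence $(x_n)$ is bundle convergent to $x$ if there is a bundle $\mathcal P_{(D_m)}$, with $D_m\in A^+$ and $\sum_m\rho(D_m)<\infty$, such that $\|p(x_n-x)^2p\|\to0$ as $n\to\infty$ for every $p\in\mathcal P_{(D_m)}$. It is almost uniformly convergent to $x$ if for every $\varepsilon>0$ there is $p\in\operatorname{Proj}A$ with $\rho(p^\perp)<\varepsilon$ and $\|p(x_n-x)^2p\|\to0$ as $n\to\infty$. **Proposition.** If $(x_n)$ is bundle convergent to $x$, then $(x_n)$ is almost uniformly convergent to $x$. -/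

import Mathlib

open Filter Topology

noncomputable section

/-- A JW-algebra on a complex Hilbert space `H`: a real linear space of bounded self-adjoint
operators, closed under the Jordan product `a ∘ b = (ab + ba) / 2` and closed in the weak
operator topology. It is not required to contain the identity operator of `H`. -/
structure JWAlgebra (H : Type*) [NormedAddCommGroup H] [InnerProductSpace ℂ H]
    [CompleteSpace H] extends Submodule ℝ (H →L[ℂ] H) where
  isSelfAdjoint' : ∀ a ∈ toSubmodule, IsSelfAdjoint a
  jordan_mem' : ∀ a ∈ toSubmodule, ∀ b ∈ toSubmodule,
    (2 : ℝ)⁻¹ • (a * b + b * a) ∈ toSubmodule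
  isClosed_wot' : IsClosed {T : H →WOT[ℂ] H | T.toCLM ∈ toSubmodule}

namespace JWAlgebra

variable {H : Type*} [NormedAddCommGroup H] [InnerProductSpace ℂ H] [CompleteSpace H]

/-- `a₁ a₂ ⋯ aₙ + aₙ ⋯ a₂ a₁ ∈ A` whenever `n ≥ 1` and `a₁, …, aₙ ∈ A`. -/
def IsReversible (A : JWAlgebra H) : Prop :=
  ∀ l : List (H →L[ℂ] H), l ≠ [] → (∀ a ∈ l, a ∈ A.toSubmodule) →
    l.prod + l.reverse.prod ∈ A.toSubmodule

/-- The common null space of the operators in `A`. -/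
def nullSpace (A : JWAlgebra H) : Submodule ℂ H :=
  ⨅ a : A.toSubmodule, LinearMap.ker (a : H →L[ℂ] H).toLinearMap

/-- The orthogonal projection onto the orthogonal complement of the common null space of `A`.
It lies in `A` and is its identity element (`oneOp_mem`, `oneOp_mul_of_mem`, `mul_oneOp_of_mem`);
it is the identity operator of `H` whenever the latter lies in `A`. -/
def oneOp (A : JWAlgebra H) : H →L[ℂ] H := A.nullSpaceᗮ.starProjection

theorem mul_oneOp_of_mem (A : JWAlgebra H) {a : H →L[ℂ] H} (ha : a ∈ A.toSubmodule) :
    a * A.oneOp = a := by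
  ext x
  have h1 : x - A.oneOp x ∈ A.nullSpace := by
    have hx := Submodule.sub_starProjection_mem_orthogonal (K := A.nullSpaceᗮ) x
    have hc : IsClosed (A.nullSpace : Set H) := by
      simp only [nullSpace, Submodule.coe_iInf]
      exact isClosed_iInter fun a => (a : H →L[ℂ] H).isClosed_ker
    have : CompleteSpace A.nullSpace := hc.completeSpace_coe
    rwa [Submodule.orthogonal_orthogonal] at hx
  have h2 : a (x - A.oneOp x) = 0 := (Submodule.mem_iInf _).1 h1 ⟨a, ha⟩
  rw [map_sub, sub_eq_zero] at h2
  exact h2.symm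

theorem oneOp_mul_of_mem (A : JWAlgebra H) {a : H →L[ℂ] H} (ha : a ∈ A.toSubmodule) :
    A.oneOp * a = a := by
  have h := congrArg star (A.mul_oneOp_of_mem ha)
  have h1 : star A.oneOp = A.oneOp := (isSelfAdjoint_starProjection _)
  rwa [star_mul, h1, (A.isSelfAdjoint' a ha).star_eq] at h

theorem mem_of_tendsto (A : JWAlgebra H) {ι : Type*} {l : Filter ι} [l.NeBot]
    {f : ι → H →L[ℂ] H} {T : H →L[ℂ] H} (hf : ∀ i, f i ∈ A.toSubmodule)
    (h : ∀ x, Tendsto (fun i => f i x) l (𝓝 (T x))) : T ∈ A.toSubmodule := by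
  refine A.isClosed_wot'.mem_of_tendsto (f := fun i => ContinuousLinearMapWOT.ofCLM (f i))
    (x := ContinuousLinearMapWOT.ofCLM T) (b := l) ?_ (Eventually.of_forall hf)
  rw [ContinuousLinearMapWOT.tendsto_iff_forall_inner_apply_tendsto]
  intro x y
  exact Tendsto.inner tendsto_const_nhds (h x)

theorem sq_mem (A : JWAlgebra H) {a : H →L[ℂ] H} (ha : a ∈ A.toSubmodule) :
    a * a ∈ A.toSubmodule := by
  have := A.jordan_mem' a ha a ha
  rwa [← two_smul ℝ (a * a), smul_smul, inv_mul_cancel₀ two_ne_zero, one_smul] at this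

theorem one_sub_pow_mem (A : JWAlgebra H) {b : H →L[ℂ] H} (hb : b ∈ A.toSubmodule) (n : ℕ) :
    1 - (1 - b) ^ n ∈ A.toSubmodule := by
  induction n with
  | zero => simp
  | succ n ih =>
    have hc : Commute b (1 - (1 - b) ^ n) :=
      (Commute.one_right b).sub_right (((Commute.one_right b).sub_right (Commute.refl b)).pow_right n)
    have h := A.jordan_mem' _ hb _ ih
    rw [← hc.eq, ← two_smul ℝ, smul_smul, inv_mul_cancel₀ two_ne_zero, one_smul] at h
    have := A.sub_mem (A.add_mem hb ih) h
    convert this using 1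
    rw [pow_succ']
    noncomm_ring

/-- The support projection of a positive contraction of `A` lies in `A`. -/
theorem support_mem (A : JWAlgebra H) {b : H →L[ℂ] H} (hb : b ∈ A.toSubmodule)
    (h0 : 0 ≤ b) (h1 : ‖b‖ ≤ 1) :
    (LinearMap.ker b.toLinearMap)ᗮ.starProjection ∈ A.toSubmodule := by
  set f : H →L[ℂ] H := 1 - b with hf
  have hf1 : ‖f‖ ≤ 1 := by
    have hb1 : b ≤ 1 := (CStarAlgebra.norm_le_one_iff_of_nonneg b h0).1 h1
    exact (CStarAlgebra.norm_le_one_iff_of_nonneg f (sub_nonneg.2 hb1)).2 (sub_le_self _ h0)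
  have hloc : LinearMap.ker b.toLinearMap = f.eqLocus (1 : H →L[ℂ] H) := by
    ext x
    simp [hf]
  refine A.mem_of_tendsto (l := atTop)
    (f := fun N : ℕ => (N : ℝ)⁻¹ • ∑ n ∈ Finset.range N, (1 - f ^ n)) (fun N => ?_) (fun x => ?_)
  · exact A.smul_mem _ (A.sum_mem fun n _ => A.one_sub_pow_mem hb n)
  · have h := f.tendsto_birkhoffAverage_orthogonalProjection hf1 x
    have h2 := (tendsto_const_nhds (x := x)).sub h
    have h3 : (LinearMap.ker b.toLinearMap)ᗮ.starProjection x =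
        x - ((f.eqLocus (1 : H →L[ℂ] H)).orthogonalProjectionOnto x : H) := by
      have : CompleteSpace (LinearMap.ker b.toLinearMap) := b.isClosed_ker.completeSpace_coe
      rw [Submodule.starProjection_orthogonal_val]
      congr 1
      refine Submodule.eq_starProjection_of_mem_orthogonal ?_ ?_
      · rw [hloc]
        exact Subtype.property _
      · rw [hloc]
        exact Submodule.sub_starProjection_mem_orthogonal x
    rw [h3]
    refine h2.congr' ?_
    filter_upwards [eventually_ge_atTop 1] with N hN
    have hN0 : (N : ℝ) ≠ 0 := by positivity
    have hN1 : (N : ℂ) ≠ 0 := by exact_mod_cast hN0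
    have hit : ∀ n, (f^[n]) x = (f ^ n) x := fun n => by
      induction n with
      | zero => rfl
      | succ n ih => rw [Function.iterate_succ_apply', ih, pow_succ']; rfl
    simp only [birkhoffAverage, birkhoffSum, hit]
    have hs : (N : ℝ)⁻¹ • (∑ n ∈ Finset.range N, (1 - f ^ n)) =
        (N : ℂ)⁻¹ • (∑ n ∈ Finset.range N, (1 - f ^ n)) := by
      rw [← Complex.coe_smul]
      push_cast
      rfl
    rw [hs]
    simp [smul_sub, ← Nat.cast_smul_eq_nsmul ℂ, smul_smul, hN1]

theorem oneOp_mem (A : JWAlgebra H) : A.oneOp ∈ A.toSubmodule := by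
  classical
  let s : Finset A.toSubmodule → (H →L[ℂ] H) := fun F => ∑ a ∈ F, (a : H →L[ℂ] H) * a
  have hsmem : ∀ F, s F ∈ A.toSubmodule := fun F => A.sum_mem fun a _ => A.sq_mem a.2
  have hs0 : ∀ F, 0 ≤ s F := fun F => Finset.sum_nonneg fun a _ => by
    have h := star_mul_self_nonneg (a : H →L[ℂ] H)
    rwa [(A.isSelfAdjoint' _ a.2).star_eq] at h
  have hker : ∀ F x, s F x = 0 ↔ ∀ a ∈ F, (a : H →L[ℂ] H) x = 0 := by
    intro F x
    constructor
    · intro h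
      have h1 : ∑ a ∈ F, ‖(a : H →L[ℂ] H) x‖ ^ 2 = 0 := by
        have h2 : inner ℂ (s F x) x = ((∑ a ∈ F, ‖(a : H →L[ℂ] H) x‖ ^ 2 : ℝ) : ℂ) := by
          simp only [s, sum_apply, sum_inner, Complex.ofReal_sum]
          refine Finset.sum_congr rfl fun a _ => ?_
          have ha := (A.isSelfAdjoint' _ a.2).isSymmetric ((a : H →L[ℂ] H) x) x
          rw [mul_apply_eq_comp]
          refine ha.trans ?_
          simp [inner_self_eq_norm_sq_to_K]
        rw [h, inner_zero_left] at h2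
        exact_mod_cast h2.symm
      intro a ha
      have := (Finset.sum_eq_zero_iff_of_nonneg fun a _ => by positivity).1 h1 a ha
      simpa using this
    · intro h
      simp only [s, sum_apply]
      exact Finset.sum_eq_zero fun a ha => by simp [h a ha]
  let U : Finset A.toSubmodule → Submodule ℂ H := fun F => (LinearMap.ker (s F).toLinearMap)ᗮ
  have hUmem : ∀ F, (U F).starProjection ∈ A.toSubmodule := by
    intro F
    have hc : 0 < (1 + ‖s F‖)⁻¹ := by positivity
    have h1 : ‖(1 + ‖s F‖)⁻¹ • s F‖ ≤ 1 := by
      rw [norm_smul, Real.norm_of_nonneg hc.le, inv_mul_le_one₀ (by positivity)]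
      linarith
    have h := A.support_mem (A.smul_mem (1 + ‖s F‖)⁻¹ (hsmem F)) (smul_nonneg hc.le (hs0 F)) h1
    have hk : LinearMap.ker ((1 + ‖s F‖)⁻¹ • s F).toLinearMap =
        LinearMap.ker (s F).toLinearMap := by
      ext x
      simp [hc.ne']
    simp_rw [hk] at h
    exact h
  have hUmono : Monotone U := fun F G hFG => Submodule.orthogonal_le fun x hx =>
    (hker F x).2 fun a ha => (hker G x).1 hx a (hFG ha)
  have hsup : (⨆ F, U F).topologicalClosure = A.nullSpaceᗮ := by
    rw [← Submodule.orthogonal_orthogonal_eq_closure, ← Submodule.iInf_orthogonal]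
    congr 1
    have hUF : ∀ F, (U F)ᗮ = LinearMap.ker (s F).toLinearMap := fun F => by
      have : CompleteSpace (LinearMap.ker (s F).toLinearMap) :=
        (s F).isClosed_ker.completeSpace_coe
      exact Submodule.orthogonal_orthogonal _
    simp_rw [hUF]
    ext x
    simp only [nullSpace, Submodule.mem_iInf]
    constructor
    · intro h a
      exact (hker {a} x).1 (h {a}) a (Finset.mem_singleton_self a)
    · intro h F
      exact (hker F x).2 fun a _ => h a
  refine A.mem_of_tendsto (l := atTop) hUmem fun x => ?_
  have h := Submodule.starProjection_tendsto_closure_iSup U hUmono x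
  simp_rw [hsup] at h
  exact h

/-- The identity element of the JW-algebra `A`. -/
def one (A : JWAlgebra H) : A.toSubmodule := ⟨A.oneOp, A.oneOp_mem⟩

/-- `ρ` is a faithful normal state on `A`. Normality is preservation of suprema (taken in `A`) of
upward directed families. -/
structure IsFaithfulNormalState (A : JWAlgebra H) (ρ : A.toSubmodule →ₗ[ℝ] ℝ) : Prop where
  nonneg : ∀ a : A.toSubmodule, 0 ≤ a → 0 ≤ ρ a
  map_one : ρ A.one = 1
  faithful : ∀ a : A.toSubmodule, 0 ≤ a → ρ a = 0 → a = 0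
  normal : ∀ (S : Set A.toSubmodule) (a : A.toSubmodule), S.Nonempty → DirectedOn (· ≤ ·) S →
    IsLUB S a → IsLUB (ρ '' S) (ρ a)

/-- `Proj A`. -/
def projections (A : JWAlgebra H) : Set A.toSubmodule :=
  {p | IsStarProjection (p : H →L[ℂ] H)}

/-- The bundle determined by a sequence `D` in `A` (used when the terms are positive and
`∑ ρ (D m) < ∞`, see `BundleConvergent`). -/
def bundle (A : JWAlgebra H) (D : ℕ → A.toSubmodule) : Set A.toSubmodule :=
  {p | p ∈ A.projections ∧ p ≠ 0 ∧
    BddAbove (Set.range fun m : ℕ =>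
      ‖(p : H →L[ℂ] H) * (∑ k ∈ Finset.range (m + 1), (D k : H →L[ℂ] H)) * (p : H →L[ℂ] H)‖) ∧
    Tendsto (fun m => ‖(p : H →L[ℂ] H) * (D m : H →L[ℂ] H) * (p : H →L[ℂ] H)‖) atTop (𝓝 0)}

/-- Bundle convergence in `A` of the sequence `x` to `y`, with respect to `ρ`. -/
def BundleConvergent (A : JWAlgebra H) (ρ : A.toSubmodule →ₗ[ℝ] ℝ)
    (x : ℕ → A.toSubmodule) (y : A.toSubmodule) : Prop :=
  ∃ D : ℕ → A.toSubmodule, (∀ m, 0 ≤ D m) ∧ Summable (fun m => ρ (D m)) ∧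
    ∀ p ∈ A.bundle D,
      Tendsto (fun n => ‖(p : H →L[ℂ] H) * ((x n : H →L[ℂ] H) - y) ^ 2 * (p : H →L[ℂ] H)‖)
        atTop (𝓝 0)

/-- Almost uniform convergence in `A` of the sequence `x` to `y`, with respect to `ρ`. -/
def AlmostUniformlyConvergent (A : JWAlgebra H) (ρ : A.toSubmodule →ₗ[ℝ] ℝ)
    (x : ℕ → A.toSubmodule) (y : A.toSubmodule) : Prop :=
  ∀ ε : ℝ, 0 < ε → ∃ p ∈ A.projections, ρ (A.one - p) < ε ∧
    Tendsto (fun n => ‖(p : H →L[ℂ] H) * ((x n : H →L[ℂ] H) - y) ^ 2 * (p : H →L[ℂ] H)‖)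
      atTop (𝓝 0)

end JWAlgebra

end

namespace ContinuousLinearMap

variable {H : Type*} [NormedAddCommGroup H] [InnerProductSpace ℂ H]

theorem reApplyInnerSelf_mono {S T : H →L[ℂ] H} (h : S ≤ T) (x : H) :
    S.reApplyInnerSelf x ≤ T.reApplyInnerSelf x := by
  have := ((le_def S T).1 h).re_inner_nonneg_left x
  simpa [reApplyInnerSelf, inner_sub_left] using this

variable [CompleteSpace H]

theorem sq_norm_apply_le_of_mem_Icc {c : H →L[ℂ] H} (h0 : 0 ≤ c) (h1 : c ≤ 1) (x : H) :
    ‖c x‖ ^ 2 ≤ c.reApplyInnerSelf x := by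
  have h : c ^ 2 ≤ c ^ 1 := CStarAlgebra.pow_antitone h0 h1 one_le_two
  have hc : IsSelfAdjoint c := .of_nonneg h0
  have h2 := reApplyInnerSelf_mono h x
  rw [pow_one] at h2
  refine le_trans (le_of_eq ?_) h2
  rw [reApplyInnerSelf, sq c]
  have h3 : inner ℂ (c (c x)) x = inner ℂ (c x) (c x) := hc.isSymmetric (c x) x
  rw [mul_apply_eq_comp, h3, inner_self_eq_norm_sq]

/-- A monotone sequence of positive contractions converges strongly. -/
theorem exists_tendsto_apply_of_monotone {b : ℕ → H →L[ℂ] H} (hb : Monotone b)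
    (h0 : ∀ n, 0 ≤ b n) (h1 : ∀ n, b n ≤ 1) :
    ∃ T : H →L[ℂ] H, ∀ x, Tendsto (fun n => b n x) atTop (𝓝 (T x)) := by
  have hconv : ∀ x, ∃ y, Tendsto (fun n => b n x) atTop (𝓝 y) := by
    intro x
    refine cauchySeq_tendsto_of_complete ?_
    have hmono : Monotone fun n => (b n).reApplyInnerSelf x := fun m n hmn =>
      reApplyInnerSelf_mono (hb hmn) x
    have hbdd : BddAbove (Set.range fun n => (b n).reApplyInnerSelf x) :=
      ⟨_, Set.forall_mem_range.2 fun n => reApplyInnerSelf_mono (h1 n) x⟩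
    have hc := (tendsto_atTop_ciSup hmono hbdd).cauchySeq
    rw [Metric.cauchySeq_iff'] at hc ⊢
    intro ε hε
    obtain ⟨N, hN⟩ := hc (ε ^ 2) (by positivity)
    refine ⟨N, fun n hn => ?_⟩
    have h2 := hN n hn
    have h3 := sq_norm_apply_le_of_mem_Icc (sub_nonneg.2 (hb hn))
      ((sub_le_self _ (h0 N)).trans (h1 n)) x
    rw [Real.dist_eq, abs_of_nonneg (sub_nonneg.2 (hmono hn))] at h2
    rw [dist_eq_norm, ← sub_apply]
    refine lt_of_pow_lt_pow_left₀ 2 hε.le (h3.trans_lt ?_)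
    simpa [reApplyInnerSelf, inner_sub_left] using h2
  choose f hf using hconv
  exact ⟨continuousLinearMapOfTendsto b (tendsto_pi_nhds.2 hf), hf⟩

theorem isLUB_range_of_tendsto_apply {b : ℕ → H →L[ℂ] H} (hb : Monotone b)
    (hsa : ∀ n, IsSelfAdjoint (b n)) {T : H →L[ℂ] H} (hTsa : IsSelfAdjoint T)
    (hT : ∀ x, Tendsto (fun n => b n x) atTop (𝓝 (T x))) :
    IsLUB (Set.range b) T := by
  have hlim : ∀ x, Tendsto (fun n => (b n).reApplyInnerSelf x) atTop (𝓝 (T.reApplyInnerSelf x)) :=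
    fun x => (RCLike.continuous_re.tendsto _).comp ((hT x).inner tendsto_const_nhds)
  refine ⟨Set.forall_mem_range.2 fun n => ?_, fun U hU => ?_⟩
  · refine (le_def _ _).2 (isPositive_def'.2 ⟨hTsa.sub (hsa n), fun x => ?_⟩)
    have := ge_of_tendsto (hlim x) ((eventually_ge_atTop n).mono fun m hm =>
      reApplyInnerSelf_mono (hb hm) x)
    simpa [reApplyInnerSelf, inner_sub_left] using this
  · have hUsa : IsSelfAdjoint U := by
      have h := ((le_def _ _).1 (hU (Set.mem_range_self 0))).isSelfAdjoint.add (hsa 0)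
      simpa using h
    refine (le_def _ _).2 (isPositive_def'.2 ⟨hUsa.sub hTsa, fun x => ?_⟩)
    have := le_of_tendsto (hlim x) (Eventually.of_forall fun m =>
      reApplyInnerSelf_mono (hU (Set.mem_range_self m)) x)
    simpa [reApplyInnerSelf, inner_sub_left] using this

end ContinuousLinearMap

/-- The terms of a convergent nonnegative series may be multiplied by factors tending to infinity
without destroying convergence. -/
theorem Summable.exists_tendsto_atTop_summable_mul {a : ℕ → ℝ} (ha : Summable a)
    (h0 : ∀ n, 0 ≤ a n) :
    ∃ w : ℕ → ℝ, (∀ n, 1 ≤ w n) ∧ Tendsto w atTop atTop ∧ Summable fun n => w n * a n := by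
  set c : ℕ → ℝ := fun n => a n + (1 / 2 : ℝ) ^ n with hc
  have hcs : Summable c := ha.add (summable_geometric_of_lt_one (by norm_num) (by norm_num))
  have hcpos : ∀ n, 0 < c n := fun n => add_pos_of_nonneg_of_pos (h0 n) (by positivity)
  set r : ℕ → ℝ := fun n => ∑' k, c (k + n) with hr
  have hsn : ∀ n, Summable fun k => c (k + n) := fun n => (summable_nat_add_iff n).2 hcs
  have hrpos : ∀ n, 0 < r n := fun n => (hsn n).tsum_pos (fun k => (hcpos _).le) 0 (hcpos _)
  have hrsucc : ∀ n, r n = c n + r (n + 1) := fun n => by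
    simp only [hr]
    rw [(hsn n).tsum_eq_zero_add]
    simp [add_comm, add_left_comm]
  have hr0 : Tendsto r atTop (𝓝 0) := tendsto_sum_nat_add c
  have hsr0 : Tendsto (fun n => √(r n)) atTop (𝓝[>] 0) := by
    refine tendsto_nhdsWithin_iff.2 ⟨?_, Eventually.of_forall fun n => Real.sqrt_pos.2 (hrpos n)⟩
    simpa using hr0.sqrt
  refine ⟨fun n => 1 + (√(r n))⁻¹, fun n => ?_, ?_, ?_⟩
  · have : 0 ≤ (√(r n))⁻¹ := by positivity
    linarith
  · exact tendsto_atTop_add_const_left _ _ hsr0.inv_tendsto_nhdsGT_zero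
  · simp_rw [add_mul, one_mul]
    refine ha.add ?_
    refine Summable.of_nonneg_of_le (f := fun n => 2 * (√(r n) - √(r (n + 1))))
      (fun n => mul_nonneg (by positivity) (h0 n)) (fun n => ?_) ?_
    · have hs := Real.sqrt_pos.2 (hrpos n)
      have hs' := Real.sqrt_nonneg (r (n + 1))
      have e1 := Real.sq_sqrt (hrpos n).le
      have e2 := Real.sq_sqrt (hrpos (n + 1)).le
      have h3 := hrsucc n
      have h4 : a n ≤ c n := by simp only [hc]; linarith [show (0 : ℝ) ≤ (1 / 2) ^ n by positivity]
      rw [inv_mul_le_iff₀ hs]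
      nlinarith [sq_nonneg (√(r n) - √(r (n + 1)))]
    · refine Summable.mul_left _ ?_
      refine summable_of_sum_range_le (c := √(r 0)) (fun n => ?_) (fun n => ?_)
      · exact sub_nonneg.2 (Real.sqrt_le_sqrt (by rw [hrsucc n]; linarith [hcpos n]))
      · rw [Finset.sum_range_sub']
        linarith [Real.sqrt_nonneg (r n)]

namespace JWAlgebra

variable {H : Type*} [NormedAddCommGroup H] [InnerProductSpace ℂ H] [CompleteSpace H]

theorem isClosed_toSubmodule (A : JWAlgebra H) : IsClosed (A.toSubmodule : Set (H →L[ℂ] H)) := by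
  refine isClosed_of_closure_subset fun T hT => ?_
  obtain ⟨f, hf, hlim⟩ := mem_closure_iff_seq_limit.1 hT
  exact A.mem_of_tendsto hf fun x =>
    ((ContinuousLinearMap.apply ℂ H x).continuous.tendsto T).comp hlim

theorem mul_mem_of_commute (A : JWAlgebra H) {a b : H →L[ℂ] H} (ha : a ∈ A.toSubmodule)
    (hb : b ∈ A.toSubmodule) (h : Commute a b) : a * b ∈ A.toSubmodule := by
  have := A.jordan_mem' a ha b hb
  rwa [← h.eq, ← two_smul ℝ (a * b), smul_smul, inv_mul_cancel₀ two_ne_zero, one_smul] at this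

/-- A JW-algebra is closed under the non-unital continuous functional calculus. -/
theorem cfcₙ_mem (A : JWAlgebra H) {a : H →L[ℂ] H} (ha : a ∈ A.toSubmodule) (f : ℝ → ℝ) :
    cfcₙ f a ∈ A.toSubmodule := by
  have hsa := A.isSelfAdjoint' a ha
  have hnormal : IsStarNormal a := hsa.isStarNormal
  have hcomm : ∀ u ∈ NonUnitalStarAlgebra.elemental ℝ a,
      ∀ v ∈ NonUnitalStarAlgebra.elemental ℝ a, Commute u v := fun u hu v hv =>
    congrArg Subtype.val (mul_comm (⟨u, hu⟩ : NonUnitalStarAlgebra.elemental ℝ a) ⟨v, hv⟩)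
  have hle : NonUnitalStarAlgebra.adjoin ℝ {a} ≤ NonUnitalStarAlgebra.elemental ℝ a :=
    NonUnitalStarSubalgebra.le_topologicalClosure _
  have hsub : (NonUnitalStarAlgebra.adjoin ℝ {a} : Set (H →L[ℂ] H)) ⊆ A.toSubmodule := by
    intro u hu
    induction hu using NonUnitalStarAlgebra.adjoin_induction with
    | mem u hu => rwa [Set.mem_singleton_iff.1 hu]
    | add u v _ _ hu hv => exact A.add_mem hu hv
    | zero => exact A.zero_mem
    | mul u v hu' hv' hu hv =>
      exact A.mul_mem_of_commute hu hv (hcomm u (hle hu') v (hle hv'))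
    | smul r u _ hu => exact A.smul_mem r hu
    | star u _ hu => rwa [SetLike.mem_coe, (A.isSelfAdjoint' u hu).star_eq]
  exact closure_minimal hsub A.isClosed_toSubmodule (cfcₙ_mem_elemental f a)

end JWAlgebra

namespace CStarAlgebra

variable {R : Type*} [CStarAlgebra R] [PartialOrder R] [StarOrderedRing R]

theorem cfcₙ_one_sub_one_add_inv_nonneg {a : R} (ha : 0 ≤ a) :
    0 ≤ cfcₙ (fun x : ℝ => 1 - (1 + x)⁻¹) a := by
  refine cfcₙ_nonneg fun x hx => ?_
  have hx0 : 0 ≤ x := quasispectrum_nonneg_of_nonneg a ha x hx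
  exact sub_nonneg.2 (inv_le_one_of_one_le₀ (by linarith))

theorem continuousOn_one_add_inv {a : R} (ha : 0 ≤ a) :
    ContinuousOn (fun x : ℝ => (1 + x)⁻¹) (spectrum ℝ a) :=
  (continuousOn_const.add continuousOn_id).inv₀ fun x hx => by
    have hx0 := spectrum_nonneg_of_nonneg ha hx
    exact (add_pos_of_pos_of_nonneg one_pos hx0).ne'

theorem one_sub_cfcₙ_one_sub_one_add_inv {a : R} (ha : 0 ≤ a) :
    1 - cfcₙ (fun x : ℝ => 1 - (1 + x)⁻¹) a = cfc (fun x : ℝ => (1 + x)⁻¹) a := by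
  have hsa : IsSelfAdjoint a := .of_nonneg ha
  have hc := continuousOn_one_add_inv ha
  have hq : ContinuousOn (fun x : ℝ => 1 - (1 + x)⁻¹) (quasispectrum ℝ a) :=
    continuousOn_const.sub ((continuousOn_const.add continuousOn_id).inv₀ fun x hx => by
      have hx0 : 0 ≤ x := quasispectrum_nonneg_of_nonneg a ha x hx
      exact (add_pos_of_pos_of_nonneg one_pos hx0).ne')
  rw [cfcₙ_eq_cfc hq, cfc_sub _ _ a, cfc_const_one ℝ a, sub_sub_cancel]

theorem one_sub_cfcₙ_mul_one_add {a : R} (ha : 0 ≤ a) :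
    (1 - cfcₙ (fun x : ℝ => 1 - (1 + x)⁻¹) a) * (1 + a) = 1 := by
  have hsa : IsSelfAdjoint a := .of_nonneg ha
  have hc := continuousOn_one_add_inv ha
  have h1 : cfc (fun x : ℝ => 1 + x) a = 1 + a := by
    rw [cfc_add a (fun _ => (1 : ℝ)) (fun x => x), cfc_const_one ℝ a, cfc_id' ℝ a]
  rw [one_sub_cfcₙ_one_sub_one_add_inv ha, ← h1, ← cfc_mul _ _ a, ← cfc_const_one ℝ a]
  refine cfc_congr fun x hx => ?_
  have hx0 := spectrum_nonneg_of_nonneg ha hx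
  exact inv_mul_cancel₀ (by positivity)

theorem cfcₙ_one_sub_one_add_inv_le_one {a : R} (ha : 0 ≤ a) :
    cfcₙ (fun x : ℝ => 1 - (1 + x)⁻¹) a ≤ 1 := by
  rw [← sub_nonneg, one_sub_cfcₙ_one_sub_one_add_inv ha]
  refine cfc_nonneg fun x hx => ?_
  have hx0 := spectrum_nonneg_of_nonneg ha hx
  positivity

theorem cfcₙ_one_sub_one_add_inv_le_self {a : R} (ha : 0 ≤ a) :
    cfcₙ (fun x : ℝ => 1 - (1 + x)⁻¹) a ≤ a := by
  have hsa : IsSelfAdjoint a := .of_nonneg ha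
  have hc := continuousOn_one_add_inv ha
  rw [← sub_le_sub_iff_left 1, one_sub_cfcₙ_one_sub_one_add_inv ha]
  have h1 : cfc (fun x : ℝ => 1 - x) a = 1 - a := by
    rw [cfc_sub _ _ a, cfc_const_one ℝ a, cfc_id' ℝ a]
  rw [← h1]
  refine cfc_mono fun x hx => ?_
  have hx0 := spectrum_nonneg_of_nonneg ha hx
  rw [inv_eq_one_div, le_div_iff₀ (by positivity)]
  nlinarith

/-- If `t ≤ r` and `s` is an inverse of `r`, then `t s t ≤ t`. -/
theorem mul_mul_self_le_of_le_inverse {t r s : R} (ht : 0 ≤ t) (hs : IsSelfAdjoint s)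
    (htr : t ≤ r) (hrs : r * s = 1) : t * s * t ≤ t := by
  have htsa : star t = t := (IsSelfAdjoint.of_nonneg ht).star_eq
  have h1 := star_left_conjugate_nonneg ht (1 - s * t)
  have h2 := star_left_conjugate_nonneg (sub_nonneg.2 htr) (s * t)
  have h3 := add_nonneg h1 h2
  simp only [star_sub, star_mul, star_one, htsa, hs.star_eq] at h3
  rw [← sub_nonneg]
  convert h3 using 1
  have h4 : t * s * r * (s * t) = t * s * t := by
    rw [mul_assoc (t * s) r, ← mul_assoc r s, hrs, one_mul]
  rw [mul_sub (t * s) r t, sub_mul _ _ (s * t), h4]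
  noncomm_ring

end CStarAlgebra

namespace JWAlgebra

variable {H : Type*} [NormedAddCommGroup H] [InnerProductSpace ℂ H] [CompleteSpace H]

/-- A positive contraction `b` of `A` has a spectral projection `q ∈ A` with `q ≤ 2 b`, such that
`1 - b` is bounded below by `1 / 2` on the complement: every `p` with `q p = 0` factors as
`p = (1 - b) g p`, where `g ≤ 2` is a positive operator. -/
theorem exists_spectral_projection (A : JWAlgebra H) {b : H →L[ℂ] H} (hb : b ∈ A.toSubmodule)
    (h0 : 0 ≤ b) (h1 : b ≤ 1) :
    ∃ q ∈ A.toSubmodule, IsStarProjection q ∧ q ≤ (2 : ℝ) • b ∧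
      ∃ g : H →L[ℂ] H, IsSelfAdjoint g ∧ g ≤ (2 : ℝ) • 1 ∧
        ∀ p : H →L[ℂ] H, q * p = 0 → (1 - b) * g * p = p := by
  have hsa : IsSelfAdjoint b := .of_nonneg h0
  set c : H →L[ℂ] H := cfcₙ (fun x : ℝ => max (x - 1 / 2) 0) b with hc
  have hcA : c ∈ A.toSubmodule := A.cfcₙ_mem hb _
  have hcf : c = cfc (fun x : ℝ => max (x - 1 / 2) 0) b :=
    cfcₙ_eq_cfc (by fun_prop) (by norm_num)
  have hc0 : 0 ≤ c := cfcₙ_nonneg fun x _ => le_max_right _ _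
  have hcsa : IsSelfAdjoint c := .of_nonneg hc0
  have hspec : ∀ x ∈ spectrum ℝ b, x ≤ 1 := fun x hx =>
    (le_algebraMap_iff_spectrum_le (r := (1 : ℝ)) (a := b)).1 (by simpa using h1) x hx
  have hc1 : c ≤ 1 := by
    rw [hcf]
    exact cfc_le_one _ _ fun x hx => max_le (by linarith [hspec x hx]) zero_le_one
  have hcn : ‖c‖ ≤ 1 := (CStarAlgebra.norm_le_one_iff_of_nonneg c hc0).2 hc1
  set d : H →L[ℂ] H := cfc (fun x : ℝ => max (1 / 2 - x) 0) b with hd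
  have hcd : c * d = 0 := by
    rw [hcf, hd, ← cfc_mul _ _ b, ← cfc_zero ℝ b]
    refine cfc_congr fun x _ => ?_
    rcases le_total x (1 / 2) with h | h
    · simp only [max_eq_right (sub_nonpos.2 h), zero_mul, Pi.zero_apply]
    · simp only [max_eq_right (sub_nonpos.2 h), mul_zero, Pi.zero_apply]
  have hb_eq : b = (1 / 2 : ℝ) • 1 + c - d := by
    have h : b = cfc (fun x : ℝ => 1 / 2 + max (x - 1 / 2) 0 - max (1 / 2 - x) 0) b := by
      conv_lhs => rw [← cfc_id' ℝ b]
      refine cfc_congr fun x _ => ?_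
      rcases le_total x (1 / 2) with h | h
      · simp only [max_eq_right (sub_nonpos.2 h), max_eq_left (sub_nonneg.2 h)]
        ring
      · simp only [max_eq_right (sub_nonpos.2 h), max_eq_left (sub_nonneg.2 h)]
        ring
    rw [cfc_sub _ _ b, cfc_add b (fun _ => (1 / 2 : ℝ)) (fun x => max (x - 1 / 2) 0),
      cfc_const _ b, ← hcf, ← hd, Algebra.algebraMap_eq_smul_one]
      at h
    exact h
  have hdsa : IsSelfAdjoint d := IsSelfAdjoint.of_nonneg (cfc_nonneg fun x _ => le_max_right _ _)
  set q : H →L[ℂ] H := (LinearMap.ker c.toLinearMap)ᗮ.starProjection with hq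
  have hqP : IsStarProjection q := isStarProjection_starProjection
  have hkc : CompleteSpace (LinearMap.ker c.toLinearMap) := c.isClosed_ker.completeSpace_coe
  have hq_of : ∀ u : H →L[ℂ] H, c * u = 0 → q * u = 0 := by
    intro u hu
    ext x
    refine (Submodule.starProjection_apply_eq_zero_iff _).2 ?_
    rw [Submodule.orthogonal_orthogonal]
    exact congrArg (· x) hu
  have hc_of : c * (1 - q) = 0 := by
    ext x
    have := Submodule.sub_starProjection_mem_orthogonal (K := (LinearMap.ker c.toLinearMap)ᗮ) x
    rw [Submodule.orthogonal_orthogonal] at this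
    exact this
  have hcq : c * q = c := by
    rw [mul_sub, mul_one, sub_eq_zero] at hc_of
    exact hc_of.symm
  have hqc : q * c = c := by
    simpa [hcsa.star_eq, hqP.isSelfAdjoint.star_eq] using congrArg star hcq
  have hqd : q * d = 0 := hq_of d hcd
  have hdq : d * q = 0 := by
    simpa [hdsa.star_eq, hqP.isSelfAdjoint.star_eq] using congrArg star hqd
  have hqb : q * b = (1 / 2 : ℝ) • q + c := by
    rw [hb_eq, mul_sub, mul_add, hqc, hqd, mul_smul_comm, mul_one, sub_zero]
  have hbq : b * q = (1 / 2 : ℝ) • q + c := by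
    rw [hb_eq, sub_mul, add_mul, hcq, hdq, smul_mul_assoc, one_mul, sub_zero]
  have hcont : ContinuousOn (fun x : ℝ => (max (1 - x) (1 / 2))⁻¹) (spectrum ℝ b) :=
    ContinuousOn.inv₀ (by fun_prop) fun x _ => (lt_max_of_lt_right (by norm_num)).ne'
  refine ⟨q, A.support_mem hcA hc0 hcn, hqP, ?_,
    cfc (fun x : ℝ => (max (1 - x) (1 / 2))⁻¹) b, cfc_predicate _ _, ?_, fun p hp => ?_⟩
  · have h2 := hqP.one_sub.isSelfAdjoint.conjugate_nonneg h0
    have h3 : (1 - q) * b * (1 - q) = b - (1 / 2 : ℝ) • q - c := by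
      have h4 : q * b * q = (1 / 2 : ℝ) • q + c := by
        rw [hqb, add_mul, hcq, smul_mul_assoc, hqP.isIdempotentElem.eq]
      rw [sub_mul, one_mul, mul_sub, mul_one, sub_mul, hbq, h4, hqb]
      abel
    rw [h3] at h2
    have h5 := smul_nonneg (zero_le_two (α := ℝ)) (add_nonneg h2 hc0)
    rw [← sub_nonneg]
    convert h5 using 1
    module
  · have := cfc_le_algebraMap (R := ℝ) (fun x : ℝ => (max (1 - x) (1 / 2))⁻¹) 2 b
      (hf := hcont) fun x _ => by
      rw [inv_le_comm₀ (lt_max_of_lt_right (by norm_num)) two_pos]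
      exact le_max_of_le_right (by norm_num)
    rwa [Algebra.algebraMap_eq_smul_one] at this
  · set g : H →L[ℂ] H := cfc (fun x : ℝ => (max (1 - x) (1 / 2))⁻¹) b with hg
    have hcp : c * p = 0 := by rw [← hcq, mul_assoc, hp, mul_zero]
    have hgc : c * g = g * c := by
      rw [hcf]
      exact cfc_commute_cfc _ _ b
    have hsum : (1 - b + c) * g = 1 := by
      have e : 1 - b + c = cfc (fun x : ℝ => max (1 - x) (1 / 2)) b := by
        have e1 : 1 - b + c = cfc (fun x : ℝ => 1 - x + max (x - 1 / 2) 0) b := by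
          rw [cfc_add b (fun x : ℝ => 1 - x) (fun x => max (x - 1 / 2) 0), cfc_sub _ _ b,
            cfc_const_one ℝ b, cfc_id' ℝ b, ← hcf]
        rw [e1]
        refine cfc_congr fun x _ => ?_
        rcases le_total x (1 / 2) with h | h
        · simp only [max_eq_right (sub_nonpos.2 h)]
          rw [max_eq_left (by linarith)]
          ring
        · simp only [max_eq_left (sub_nonneg.2 h)]
          rw [max_eq_right (by linarith)]
          ring
      rw [e, hg, ← cfc_mul _ _ b (hg := hcont), ← cfc_const_one ℝ b]
      exact cfc_congr fun x _ => mul_inv_cancel₀ (lt_max_of_lt_right (by norm_num)).ne'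
    have h6 : (1 - b) * g * p = (1 - b + c) * g * p - g * (c * p) := by
      rw [add_mul, hgc]
      noncomm_ring
    rw [h6, hsum, hcp, one_mul, mul_zero, sub_zero]

/-- Chebyshev inequality for a monotone sequence of positive elements. -/
theorem IsFaithfulNormalState.exists_projection_norm_le {A : JWAlgebra H}
    {ρ : A.toSubmodule →ₗ[ℝ] ℝ} (hρ : A.IsFaithfulNormalState ρ) {S : ℕ → A.toSubmodule}
    (hS0 : ∀ n, 0 ≤ S n) (hS : Monotone S) {C : ℝ} (hC : ∀ n, ρ (S n) ≤ C) :
    ∃ p ∈ A.projections, ρ (A.one - p) ≤ 2 * C ∧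
      ∀ n, ‖(p : H →L[ℂ] H) * (S n : H →L[ℂ] H) * (p : H →L[ℂ] H)‖ ≤ 2 := by
  have hρmono : ∀ u v : A.toSubmodule, u ≤ v → ρ u ≤ ρ v := fun u v huv => by
    have := hρ.nonneg (v - u) (sub_nonneg.2 huv)
    rwa [map_sub, sub_nonneg] at this
  have hS0' : ∀ n, 0 ≤ (S n : H →L[ℂ] H) := hS0
  set b : ℕ → H →L[ℂ] H := fun n => cfcₙ (fun x : ℝ => 1 - (1 + x)⁻¹) (S n : H →L[ℂ] H) with hb
  have hbA : ∀ n, b n ∈ A.toSubmodule := fun n => A.cfcₙ_mem (S n).2 _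
  have hb0 : ∀ n, 0 ≤ b n := fun n => CStarAlgebra.cfcₙ_one_sub_one_add_inv_nonneg (hS0' n)
  have hb1 : ∀ n, b n ≤ 1 := fun n => CStarAlgebra.cfcₙ_one_sub_one_add_inv_le_one (hS0' n)
  have hbm : Monotone b := fun m n hmn =>
    CFC.monotoneOn_one_sub_one_add_inv_real (hS0' m) (hS0' n) (hS hmn)
  obtain ⟨B, hB⟩ := ContinuousLinearMap.exists_tendsto_apply_of_monotone hbm hb0 hb1
  have hBA : B ∈ A.toSubmodule := A.mem_of_tendsto hbA hB
  have hlub := ContinuousLinearMap.isLUB_range_of_tendsto_apply hbm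
    (fun n => .of_nonneg (hb0 n)) (A.isSelfAdjoint' B hBA) hB
  have hbB : ∀ n, b n ≤ B := fun n => hlub.1 (Set.mem_range_self n)
  have hB1 : B ≤ 1 := hlub.2 (Set.forall_mem_range.2 hb1)
  have hB0 : 0 ≤ B := (hb0 0).trans (hbB 0)
  have hρB : ρ ⟨B, hBA⟩ ≤ C := by
    have h := hρ.normal (Set.range fun n => (⟨b n, hbA n⟩ : A.toSubmodule)) ⟨B, hBA⟩
      (Set.range_nonempty _) (directedOn_range.2 (Monotone.directed_le
        (f := fun n => (⟨b n, hbA n⟩ : A.toSubmodule)) fun m n hmn => hbm hmn))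
      ⟨Set.forall_mem_range.2 fun n => hbB n, fun U hU => hlub.2 (Set.forall_mem_range.2 fun n =>
        hU (Set.mem_range_self n))⟩
    refine h.2 ?_
    rintro _ ⟨_, ⟨n, rfl⟩, rfl⟩
    have hle : b n ≤ (S n : H →L[ℂ] H) :=
      CStarAlgebra.cfcₙ_one_sub_one_add_inv_le_self (hS0' n)
    exact (hρmono _ (S n) hle).trans (hC n)
  obtain ⟨q, hqA, hqP, hqB, g, hgsa, hg2, hgp⟩ := A.exists_spectral_projection hBA hB0 hB1
  have h1q := A.oneOp_mul_of_mem hqA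
  have hq1 := A.mul_oneOp_of_mem hqA
  have hpP : IsStarProjection (A.oneOp - q) := by
    refine ⟨?_, ?_⟩
    · have := (isStarProjection_starProjection (U := A.nullSpaceᗮ)).isIdempotentElem.eq
      change (A.oneOp - q) * (A.oneOp - q) = A.oneOp - q
      change A.oneOp * A.oneOp = A.oneOp at this
      rw [sub_mul, mul_sub, mul_sub, this, h1q, hq1, hqP.isIdempotentElem.eq, sub_self, sub_zero]
    · exact (A.isSelfAdjoint' _ A.oneOp_mem).sub hqP.isSelfAdjoint
  refine ⟨A.one - ⟨q, hqA⟩, hpP, ?_, fun n => ?_⟩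
  · rw [sub_sub_cancel]
    have h := hρmono ⟨q, hqA⟩ ((2 : ℝ) • ⟨B, hBA⟩) hqB
    rw [map_smul, smul_eq_mul] at h
    linarith
  · change ‖(A.oneOp - q) * (S n : H →L[ℂ] H) * (A.oneOp - q)‖ ≤ 2
    set p := A.oneOp - q with hp
    have hpsa := hpP.isSelfAdjoint
    have hp0 : q * p = 0 := by rw [hp, mul_sub, hq1, hqP.isIdempotentElem.eq, sub_self]
    have hfac := hgp p hp0
    have hfac' : p * g * (1 - B) = p := by
      have := congrArg star hfac
      simpa [hpsa.star_eq, hgsa.star_eq, (A.isSelfAdjoint' B hBA).star_eq, mul_assoc] using this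
    have hSsa : IsSelfAdjoint (1 + (S n : H →L[ℂ] H)) :=
      (IsSelfAdjoint.one _).add (.of_nonneg (hS0' n))
    have hT : (1 - B) * (1 + (S n : H →L[ℂ] H)) * (1 - B) ≤ 1 - B :=
      CStarAlgebra.mul_mul_self_le_of_le_inverse (r := 1 - b n) (sub_nonneg.2 hB1) hSsa
        (sub_le_sub_left (hbB n) 1) (CStarAlgebra.one_sub_cfcₙ_mul_one_add (hS0' n))
    have h1 : p * (1 + (S n : H →L[ℂ] H)) * p ≤ p * g * p := by
      have h := star_left_conjugate_le_conjugate hT (g * p)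
      rw [star_mul, hpsa.star_eq, hgsa.star_eq] at h
      calc p * (1 + (S n : H →L[ℂ] H)) * p
          = (p * g * (1 - B)) * (1 + (S n : H →L[ℂ] H)) * ((1 - B) * g * p) := by
            rw [hfac, hfac']
        _ = p * g * ((1 - B) * (1 + (S n : H →L[ℂ] H)) * (1 - B)) * (g * p) := by
            simp only [mul_assoc]
        _ ≤ p * g * (1 - B) * (g * p) := h
        _ = p * g * p := by rw [hfac', mul_assoc]
    have h2 : p * g * p ≤ (2 : ℝ) • p := by
      have h := hpsa.conjugate_le_conjugate hg2
      rwa [mul_smul_comm, mul_one, smul_mul_assoc, hpP.isIdempotentElem.eq] at h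
    have h3 : p * (S n : H →L[ℂ] H) * p ≤ p * (1 + (S n : H →L[ℂ] H)) * p :=
      hpsa.conjugate_le_conjugate (le_add_of_nonneg_left zero_le_one)
    have h4 : (2 : ℝ) • p ≤ algebraMap ℝ (H →L[ℂ] H) 2 := by
      rw [Algebra.algebraMap_eq_smul_one]
      exact smul_le_smul_of_nonneg_left hpP.le_one zero_le_two
    exact (CStarAlgebra.norm_le_iff_le_algebraMap _ zero_le_two
      (hpsa.conjugate_nonneg (hS0' n))).2 (h3.trans (h1.trans (h2.trans h4)))

instance (A : JWAlgebra H) : PosSMulMono ℝ A.toSubmodule :=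
  ⟨fun r hr u v huv => by
    have h : r • (u : H →L[ℂ] H) ≤ r • (v : H →L[ℂ] H) := smul_le_smul_of_nonneg_left huv hr
    exact h⟩

/-- Every bundle contains projections of state arbitrarily close to one. -/
theorem IsFaithfulNormalState.exists_mem_bundle {A : JWAlgebra H}
    {ρ : A.toSubmodule →ₗ[ℝ] ℝ} (hρ : A.IsFaithfulNormalState ρ) {D : ℕ → A.toSubmodule}
    (hD0 : ∀ m, 0 ≤ D m) (hD : Summable fun m => ρ (D m)) {ε : ℝ} (hε : 0 < ε) :
    ∃ p ∈ A.bundle D, ρ (A.one - p) < ε := by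
  obtain ⟨w, hw1, hw, hws⟩ := hD.exists_tendsto_atTop_summable_mul fun m => hρ.nonneg _ (hD0 m)
  have hw0 : ∀ k, 0 ≤ w k := fun k => zero_le_one.trans (hw1 k)
  set C : ℝ := ∑' m, w m * ρ (D m) with hC
  have hterm : ∀ k, 0 ≤ w k • D k := fun k => smul_nonneg (hw0 k) (hD0 k)
  have hterm' : ∀ k, 0 ≤ w k * ρ (D k) := fun k => mul_nonneg (hw0 k) (hρ.nonneg _ (hD0 k))
  have hC0 : 0 ≤ C := tsum_nonneg hterm'
  set δ : ℝ := min ε 1 with hδ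
  have hδ0 : 0 < δ := lt_min hε one_pos
  obtain ⟨t, ht0, htC⟩ : ∃ t : ℝ, 0 < t ∧ 2 * (t * C) < δ := by
    refine ⟨δ / (4 * (C + 1)), by positivity, ?_⟩
    rw [div_mul_eq_mul_div, mul_div_assoc', div_lt_iff₀ (by positivity)]
    nlinarith
  set S : ℕ → A.toSubmodule := fun n => t • ∑ k ∈ Finset.range (n + 1), w k • D k with hS
  have hS0 : ∀ n, 0 ≤ S n := fun n => smul_nonneg ht0.le (Finset.sum_nonneg fun k _ => hterm k)
  have hSm : Monotone S := fun m n hmn => smul_le_smul_of_nonneg_left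
    (Finset.sum_le_sum_of_subset_of_nonneg (Finset.range_mono (by omega)) fun k _ _ => hterm k)
    ht0.le
  obtain ⟨p, hp, hρp, hpS⟩ := hρ.exists_projection_norm_le hS0 hSm (C := t * C) fun n => by
    simp only [hS, map_smul, map_sum, smul_eq_mul]
    exact mul_le_mul_of_nonneg_left (hws.sum_le_tsum _ fun k _ => hterm' k) ht0.le
  have hpδ := hρp.trans_lt htC
  have hpsa : IsSelfAdjoint (p : H →L[ℂ] H) := IsStarProjection.isSelfAdjoint hp
  have hbound : ∀ (u : A.toSubmodule) (n : ℕ), 0 ≤ u → u ≤ S n →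
      ‖(p : H →L[ℂ] H) * (u : H →L[ℂ] H) * (p : H →L[ℂ] H)‖ ≤ 2 := fun u n hu0 hu =>
    (CStarAlgebra.norm_le_norm_of_nonneg_of_le (hpsa.conjugate_nonneg hu0)
      (hpsa.conjugate_le_conjugate (show (u : H →L[ℂ] H) ≤ S n from hu))).trans (hpS n)
  refine ⟨p, ⟨hp, ?_, ⟨2 / t, Set.forall_mem_range.2 fun n => ?_⟩, ?_⟩,
    hpδ.trans_le (min_le_left _ _)⟩
  · rintro rfl
    rw [sub_zero, hρ.map_one] at hpδ
    exact absurd hpδ (not_lt.2 (min_le_right _ _))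
  · have h := hbound (t • ∑ k ∈ Finset.range (n + 1), D k) n
      (smul_nonneg ht0.le (Finset.sum_nonneg fun k _ => hD0 k))
      (smul_le_smul_of_nonneg_left (Finset.sum_le_sum fun k _ => by
        have := smul_nonneg (sub_nonneg.2 (hw1 k)) (hD0 k)
        rwa [sub_smul, one_smul, sub_nonneg] at this) ht0.le)
    rw [Submodule.coe_smul, mul_smul_comm, smul_mul_assoc, norm_smul, Real.norm_of_nonneg ht0.le,
      Submodule.coe_sum] at h
    rw [le_div_iff₀ ht0, mul_comm]
    exact h
  · have hlim : Tendsto (fun m => 2 / t * (w m)⁻¹) atTop (𝓝 0) := by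
      simpa using (tendsto_inv_atTop_zero.comp hw).const_mul (2 / t)
    refine squeeze_zero (fun _ => norm_nonneg _) (fun m => ?_) hlim
    have h := hbound (t • w m • D m) m (smul_nonneg ht0.le (hterm m))
      (smul_le_smul_of_nonneg_left (Finset.single_le_sum (f := fun k => w k • D k)
        (fun k _ => hterm k) (Finset.self_mem_range_succ m)) ht0.le)
    rw [smul_smul, Submodule.coe_smul, mul_smul_comm, smul_mul_assoc, norm_smul,
      Real.norm_of_nonneg (mul_nonneg ht0.le (hw0 m))] at h
    have hwpos : 0 < w m := one_pos.trans_le (hw1 m)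
    rw [← div_eq_mul_inv, div_div, le_div_iff₀ (by positivity), mul_comm]
    exact h

end JWAlgebra

theorem proposition3p6 {H : Type*} [NormedAddCommGroup H] [InnerProductSpace ℂ H]
    [CompleteSpace H] (A : JWAlgebra H) (hA : A.IsReversible)
    (ρ : A.toSubmodule →ₗ[ℝ] ℝ) (hρ : A.IsFaithfulNormalState ρ)
    (x : ℕ → A.toSubmodule) (y : A.toSubmodule) (h : A.BundleConvergent ρ x y) :
    A.AlmostUniformlyConvergent ρ x y := by
  intro ε hε
  obtain ⟨D, hD0, hD, hconv⟩ := h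
  obtain ⟨p, hp, hpε⟩ := hρ.exists_mem_bundle hD0 hD hε
  exact ⟨p, hp.1, hpε, hconv p hp⟩
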